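/- Let $K$ be a field of characteristic zero, let $V$ be a $K$-vector space with countable basis $e_1,e_2,\dots$, and let $E=E_0\oplus E_1$ be its (unital) Grassmann algebra, where $E_0$ (resp. $E_1$) is the span of the products of an even (resp. odd) number of elements of $V$. An involution of a $K$-algebra $A$ is a $K$-linear map $*:A\to A$ with $(ab)^*=b^*a^*$ and $(a^*)^*=a$. In the free algebra $K\langle x_1,x_1^*,x_2,x_2^*,\dots\rangle$ put $y_i=\tfrac12(x_i+x_i^*)$ and $z_i=\tfrac12(x_i-x_i^*)$. A polynomial $g(x_1,\dots,x_N,x_1^*,\dots,x_N^*)$ is called a $*$-central polynomial of an algebra with involution $(A,*)$ if $g(a_1,\dots,a_N,a_1^*,\dots,a_N^*)$ lies in the centre $Z(A)$ for all $a_1,\dots,a_N\in A$; a polynomial $f(x_1,\dots,x_N)$ is called an (ordinary) central polynomial of $A$ if $f(a_1,\dots,a_N)\in Z(A)$ for all $a_1,\dots,a_N\in A$. Let $\beta$ be an involution of $E$ with $\beta(V)\subseteq V$. (a) Let $\alpha$ be an involution of $M_n(K)$ and let $\gamma$ be the involution of $M_n(E)\cong M_n(K)\otimes E$ with $\gamma(a\otimes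 w)=\alpha(a)\otimes\beta(w)$. Then for all $l,m\ge 0$ and every $f(x_1,\dots,x_{l+m})$ in the free associative algebra, $f(y_1,\dots,y_l,z_1,\dots,z_m)$ is a $*$-central polynomial of $(M_n(E),\gamma)$ if and only if $f(x_1,\dots,x_{l+m})$ is a central polynomial of $M_n(E)$. (b) Let $M_{k,l}(E)\subseteq M_{k+l}(E)$ be the subalgebra of the matrices $\begin{pmatrix}a&b\\c&d\end{pmatrix}$ with $a\in M_k(E_0)$, $b\in M_{k\times l}(E_1)$, $c\in M_{l\times k}(E_1)$, $d\in M_l(E_0)$. Let $\alpha$ be an involution of $M_{k+l}(K)$ that maps each component of the $\mathbb Z_2$-grading of $M_{k+l}(K)$ into itself, where $e_{ij}$ has degree $0$ if $i,j\le k$ or $i,j>k$, and degree $1$ otherwise, and let $\gamma$ be the involution of $M_{k+l}(E)$ induced by $(\alpha,\beta)$ as in (a). Then $\gamma$ maps $M_{k,l}(E)$ into itself, and for all $r,s\ge 0$ and every $f(x_1,\dots,x_{r+s})$ in the free associative algebra, $f(y_1,\dots,y_r,z_1,\dots,z_s)$ is a $*$-central polynomial of $(M_{k,l}(E),\gamma)$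 if and only if $f(x_1,\dots,x_{r+s})$ is a central polynomial of $M_{k,l}(E)$. -/

import Mathlib

open scoped TensorProduct

noncomputable section

namespace StarCentral

/-- An involution (of the first kind) on an algebra `A` over `K`: a `K`-linear map of order at most
two that reverses products. -/
structure AlgInvolution (K A : Type*) [Field K] [Ring A] [Algebra K A] extends A →ₗ[K] A where
  map_mul_rev' : ∀ a b : A, toFun (a * b) = toFun b * toFun a
  involutive' : ∀ a : A, toFun (toFun a) = a

namespace AlgInvolution

variable {K A : Type*} [Field K] [Ring A] [Algebra K A]

instance : CoeFun (AlgInvolution K A) (fun _ => A → A) := ⟨fun σ => σ.toLinearMap⟩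

theorem map_mul_rev (σ : AlgInvolution K A) (a b : A) : σ (a * b) = σ b * σ a :=
  σ.map_mul_rev' a b

theorem involutive (σ : AlgInvolution K A) (a : A) : σ (σ a) = a := σ.involutive' a

/-- The involution induced on a subalgebra that is mapped into itself. -/
def restrict (σ : AlgInvolution K A) (S : Subalgebra K A) (h : ∀ a ∈ S, σ a ∈ S) :
    AlgInvolution K S where
  toFun a := ⟨σ a, h a a.2⟩
  map_add' a b := Subtype.ext (σ.toLinearMap.map_add a b)
  map_smul' c a := Subtype.ext (σ.toLinearMap.map_smul c a)
  map_mul_rev' a b := Subtype.ext (σ.map_mul_rev a b)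
  involutive' a := Subtype.ext (σ.involutive a)

/-- The involution on `B` transported to `A` along an isomorphism of algebras. -/
def transport {B : Type*} [Ring B] [Algebra K B] (e : A ≃ₐ[K] B) (σ : AlgInvolution K B) :
    AlgInvolution K A where
  toLinearMap := e.symm.toLinearMap ∘ₗ σ.toLinearMap ∘ₗ e.toLinearMap
  map_mul_rev' a b := by
    change e.symm (σ (e (a * b))) = e.symm (σ (e b)) * e.symm (σ (e a))
    rw [map_mul, σ.map_mul_rev, map_mul]
  involutive' a := by
    change e.symm (σ (e (e.symm (σ (e a))))) = a
    rw [e.apply_symm_apply, σ.involutive, e.symm_apply_apply]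

/-- The involution `a ⊗ b ↦ σ a ⊗ τ b` on the (ordinary, ungraded) tensor product. -/
def tensor {B : Type*} [Ring B] [Algebra K B] (σ : AlgInvolution K A) (τ : AlgInvolution K B) :
    AlgInvolution K (A ⊗[K] B) where
  toLinearMap := TensorProduct.map σ.toLinearMap τ.toLinearMap
  map_mul_rev' x y := by
    change TensorProduct.map σ.toLinearMap τ.toLinearMap (x * y) =
      TensorProduct.map σ.toLinearMap τ.toLinearMap y *
        TensorProduct.map σ.toLinearMap τ.toLinearMap x
    induction x using TensorProduct.induction_on with
    | zero => simp
    | add x₁ x₂ h₁ h₂ => rw [add_mul, map_add, h₁, h₂, map_add, mul_add]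
    | tmul a b =>
      induction y using TensorProduct.induction_on with
      | zero => simp
      | add y₁ y₂ h₁ h₂ => rw [mul_add, map_add, h₁, h₂, map_add, add_mul]
      | tmul c d =>
        simp only [Algebra.TensorProduct.tmul_mul_tmul, TensorProduct.map_tmul]
        rw [σ.map_mul_rev, τ.map_mul_rev]
  involutive' x := by
    change TensorProduct.map σ.toLinearMap τ.toLinearMap
      (TensorProduct.map σ.toLinearMap τ.toLinearMap x) = x
    induction x using TensorProduct.induction_on with
    | zero => simp
    | add x₁ x₂ h₁ h₂ => rw [map_add, map_add, h₁, h₂]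
    | tmul a b =>
      simp only [TensorProduct.map_tmul]
      rw [σ.involutive, τ.involutive]

end AlgInvolution

section Polynomials

variable (K : Type*) [Field K]

/-- The free algebra `K⟨x_1, x_1^*, x_2, x_2^*, …⟩`; `Sum.inl i` stands for `x_i` and `Sum.inr i`
for `x_i^*` (indices start at `0`). -/
abbrev FreeStarAlgebra := FreeAlgebra K (ℕ ⊕ ℕ)

/-- `y_i = (x_i + x_i^*) / 2`. -/
def y (i : ℕ) : FreeStarAlgebra K :=
  (2⁻¹ : K) • (FreeAlgebra.ι K (Sum.inl i) + FreeAlgebra.ι K (Sum.inr i))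

/-- `z_i = (x_i - x_i^*) / 2`. -/
def z (i : ℕ) : FreeStarAlgebra K :=
  (2⁻¹ : K) • (FreeAlgebra.ι K (Sum.inl i) - FreeAlgebra.ι K (Sum.inr i))

variable {K}

/-- The `*`-polynomial `f(y_1, …, y_r, z_1, …, z_s)` for `f = f(x_1, …, x_{r+s})`. -/
def substYZ {r s : ℕ} (f : FreeAlgebra K (Fin (r + s))) : FreeStarAlgebra K :=
  FreeAlgebra.lift K (Fin.append (fun i : Fin r => y K i) (fun j : Fin s => z K j)) f

/-- `f` is an (ordinary) central polynomial of `A`: all its values lie in the centre of `A`.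
Polynomial identities and constants count as central polynomials. -/
def IsCentralPolynomial {X : Type*} (A : Type*) [Ring A] [Algebra K A] (f : FreeAlgebra K X) :
    Prop :=
  ∀ a : X → A, FreeAlgebra.lift K a f ∈ Subalgebra.center K A

/-- `f` is a central polynomial with involution of `(A, σ)`:
`f(a_1, a_2, …, σ a_1, σ a_2, …)` lies in the centre of `A` for all `a_1, a_2, …` in `A`. -/
def IsStarCentralPolynomial {A : Type*} [Ring A] [Algebra K A] (σ : AlgInvolution K A)
    (f : FreeStarAlgebra K) : Prop :=
  ∀ a : ℕ → A, FreeAlgebra.lift K (Sum.elim a (fun i => σ (a i))) f ∈ Subalgebra.center K A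

end Polynomials

section Grassmann

variable (K : Type*) [Field K]

/-- The Grassmann algebra `E` of the vector space `V = ℕ →₀ K` with countable basis
`e_1, e_2, …`. -/
abbrev Grassmann := ExteriorAlgebra K (ℕ →₀ K)

/-- The canonical copy of `V` inside `E`. -/
def gens : Submodule K (Grassmann K) := LinearMap.range (ExteriorAlgebra.ι K)

/-- `E_0` and `E_1`: the spans of the products of an even, respectively odd, number of elements
of `V`. -/
def parity (g : ZMod 2) : Submodule K (Grassmann K) :=
  CliffordAlgebra.evenOdd (0 : QuadraticForm K (ℕ →₀ K)) g

variable {K}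

/-- The involution on `M_n(E) ≅ E ⊗ M_n(K)` induced by involutions `α` of `M_n(K)` and `β`
of `E`. -/
def inducedInvolution {n : ℕ} (α : AlgInvolution K (Matrix (Fin n) (Fin n) K))
    (β : AlgInvolution K (Grassmann K)) :
    AlgInvolution K (Matrix (Fin n) (Fin n) (Grassmann K)) :=
  (β.tensor α).transport (matrixEquivTensor (Fin n) K (Grassmann K))

/-- The map `μ_{k,l}`: degree `0` for the first `k` indices and degree `1` for the last `l`. -/
def idxDeg (k l : ℕ) (i : Fin (k + l)) : ZMod 2 := if (i : ℕ) < k then 0 else 1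

variable (K)

/-- The component of degree `g` of the elementary grading of `M_{k+l}(K)` induced by
`μ_{k,l}`: the span of the elementary matrices `e_{ij}` with `μ j - μ i = g`. -/
def gradedComponent (k l : ℕ) (g : ZMod 2) : Submodule K (Matrix (Fin (k + l)) (Fin (k + l)) K) :=
  Submodule.span K
    {M | ∃ i j, idxDeg k l j - idxDeg k l i = g ∧ M = Matrix.single i j (1 : K)}

/-- The subalgebra `M_{k,l}(E)` of `M_{k+l}(E)`: the diagonal blocks have entries in `E_0` and the
off-diagonal blocks have entries in `E_1`. -/
def Mkl (k l : ℕ) : Subalgebra K (Matrix (Fin (k + l)) (Fin (k + l)) (Grassmann K)) where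
  carrier := {M | ∀ i j, M i j ∈ parity K (idxDeg k l j - idxDeg k l i)}
  add_mem' hM hN i j := Submodule.add_mem _ (hM i j) (hN i j)
  mul_mem' {M N} hM hN i j := by
    rw [Matrix.mul_apply]
    refine Submodule.sum_mem _ fun t _ => ?_
    have h := CliffordAlgebra.evenOdd_mul_le (0 : QuadraticForm K (ℕ →₀ K)) _ _
      (Submodule.mul_mem_mul (hM i t) (hN t j))
    rwa [show idxDeg k l t - idxDeg k l i + (idxDeg k l j - idxDeg k l t) =
      idxDeg k l j - idxDeg k l i by ring] at h
  algebraMap_mem' c i j := by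
    rw [Matrix.algebraMap_matrix_apply]
    split_ifs with h
    · subst h
      rw [sub_self]
      exact SetLike.algebraMap_mem_graded
        (CliffordAlgebra.evenOdd (0 : QuadraticForm K (ℕ →₀ K))) c
    · exact Submodule.zero_mem _

end Grassmann

end StarCentral

end

/-!
The forward directions are nearly formal: a value of `f(y, z)` is a value of `f` at symmetric and
skew elements. The point is the converse, which holds for every algebra `A` with involution `σ` in
which the central skew elements of square zero act jointly faithfully (`HasFaithfulSkewCenter`).

Write `a = a⁺ + a⁻` for the decomposition into symmetric and skew parts. If `u` is central and skew,
then `a⁺ + u a⁻` is symmetric and `a⁻ + u a⁺` is skew. So if `f(y, z)` is a `*`-central polynomial,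
then the polynomial `F ∈ A[X]` obtained by evaluating `f` at elements `a⁺ + a⁻ X` and `a⁻ + a⁺ X`
takes central values at all central skew `u`. Hence `b F - F b` vanishes at all of them, for every
`b`. By `HasFaithfulSkewCenter.polynomial_eq_zero` it is then the zero polynomial, and setting
`X = 1` shows that `f(a)` commutes with `b`.

For the Grassmann algebra, one of the two eigenspaces of `β` on `V` is infinite-dimensional. For `v`
and `w` in that eigenspace, `v w` is central, of square zero and skew, since
`β (v w) = β w * β v = w v = -v w`. For `x ≠ 0` only the vectors `v` in a finite-dimensional
subspace can satisfy `v x = 0` (`exists_finite_forall_mul_ne_zero`), so `w` and then `v` can be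
chosen with `v w x ≠ 0`. The scalar matrices with entry `v w` carry this over to `M_n(E)` and to
`M_{k,l}(E)`; the latter is stable under the involution because `β` preserves the parity.
-/

open scoped TensorProduct Polynomial

noncomputable section

namespace StarCentral

/-! ### Central polynomials of algebras with involution -/

section General

variable {K A : Type*} [Field K] [Ring A] [Algebra K A]

theorem AlgInvolution.map_one (σ : AlgInvolution K A) : σ 1 = 1 := by
  have h := σ.map_mul_rev (σ 1) 1
  rw [mul_one, σ.involutive, mul_one] at h
  exact h.symm

variable (K) in
/-- The `K`-algebra homomorphism `A[X] → A` that evaluates at a central element. -/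
def evalCentral (u : A) (hu : u ∈ Subalgebra.center K A) : A[X] →ₐ[K] A :=
  { Polynomial.eval₂RingHom' (RingHom.id A) u fun a => Subalgebra.mem_center_iff.mp hu a with
    commutes' := fun _ => Polynomial.eval_C }

theorem evalCentral_apply (u : A) (hu : u ∈ Subalgebra.center K A) (p : A[X]) :
    evalCentral K u hu p = p.eval u := rfl

theorem _root_.Commute.add_pow_succ_of_mul_self_eq_zero {R : Type*} [Semiring R] {u v : R}
    (h : Commute u v) (hv : v * v = 0) (n : ℕ) :
    (u + v) ^ (n + 1) = u ^ (n + 1) + (n + 1 : ℕ) * u ^ n * v := by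
  induction n with
  | zero => simp
  | succ n ih =>
    rw [pow_succ, ih, add_mul, mul_add, mul_add, mul_assoc _ v v, hv, mul_zero, add_zero,
      mul_assoc _ v u, ← h.eq, ← mul_assoc, mul_assoc _ (u ^ n) u, ← pow_succ, ← pow_succ,
      add_assoc, Nat.cast_add (n + 1) 1, Nat.cast_one, add_mul, one_mul, add_mul,
      add_comm (u ^ (n + 1) * v)]

theorem eval_add_of_mul_self_eq_zero {R : Type*} [Semiring R] {u v : R} (h : Commute u v)
    (hv : v * v = 0) (p : R[X]) :
    p.eval (u + v) = p.eval u + p.derivative.eval u * v := by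
  induction p using Polynomial.induction_on' with
  | add p q hp hq =>
    rw [Polynomial.eval_add, hp, hq, Polynomial.eval_add, Polynomial.derivative_add,
      Polynomial.eval_add, add_mul]
    abel
  | monomial n a =>
    rw [Polynomial.derivative_monomial]
    simp only [Polynomial.eval_monomial]
    cases n with
    | zero => simp
    | succ n =>
      rw [h.add_pow_succ_of_mul_self_eq_zero hv, mul_add, Nat.add_sub_cancel]
      simp only [mul_assoc]

/-- The central skew elements of square zero act jointly faithfully: no nonzero element of `A` is
annihilated by all of them. -/
def HasFaithfulSkewCenter (σ : AlgInvolution K A) : Prop :=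
  ∀ x : A, x ≠ 0 → ∃ u ∈ Subalgebra.center K A, σ u = -u ∧ u * u = 0 ∧ u * x ≠ 0

/-- If `u` and `v` are central and skew with `v ^ 2 = 0`, then `p(u + v) - p(u) = p'(u) v`, so
that `p'` vanishes on the central skew elements as soon as `p` does; this allows an induction on
the degree. -/
theorem HasFaithfulSkewCenter.polynomial_eq_zero [CharZero K] {σ : AlgInvolution K A}
    (hσ : HasFaithfulSkewCenter σ) (p : A[X])
    (hp : ∀ u ∈ Subalgebra.center K A, σ u = -u → p.eval u = 0) : p = 0 := by
  have : IsAddTorsionFree A := by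
    let _ : Algebra ℚ A := Algebra.compHom A (algebraMap ℚ K)
    exact IsAddTorsionFree.of_module_rat A
  have h0 : σ 0 = -0 := by rw [neg_zero]; exact σ.toLinearMap.map_zero
  induction hN : p.natDegree using Nat.strong_induction_on generalizing p with
  | _ N ih =>
  -- It suffices that `p` is constant, because `0` is central and skew.
  have hdeg : p.natDegree = 0 := by
    by_contra hne
    have hd := ih _ (hN ▸ Polynomial.natDegree_derivative_lt hne) p.derivative ?_ rfl
    · exact hne (Polynomial.derivative_eq_zero.mp hd)
    · intro u hu hus
      by_contra hx
      obtain ⟨v, hv, hvs, hv2, hvx⟩ := hσ _ hx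
      have hcomm : Commute u v := (Subalgebra.mem_center_iff.mp hv u)
      have h := eval_add_of_mul_self_eq_zero hcomm hv2 p
      rw [hp u hu hus, zero_add, hp (u + v) (add_mem hu hv)
        (by rw [map_add, hus, hvs, neg_add])] at h
      exact hvx (by rw [← Subalgebra.mem_center_iff.mp hv, ← h])
  rw [Polynomial.eq_C_of_natDegree_eq_zero hdeg] at hp ⊢
  rw [← Polynomial.eval_C (a := p.coeff 0) (x := 0), hp 0 (zero_mem _) h0, Polynomial.C_0]

/-- The value of `f(y, z)` at a tuple of elements of `A` is the value of `f` at the symmetric,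
respectively skew, parts. -/
theorem lift_substYZ (σ : AlgInvolution K A) {r s : ℕ} (f : FreeAlgebra K (Fin (r + s)))
    (a : ℕ → A) :
    FreeAlgebra.lift K (Sum.elim a fun i => σ (a i)) (substYZ f) =
      FreeAlgebra.lift K (Fin.append (fun i : Fin r => (2⁻¹ : K) • (a i + σ (a i)))
        (fun j : Fin s => (2⁻¹ : K) • (a j - σ (a j)))) f := by
  rw [substYZ, ← AlgHom.comp_apply]
  congr 1
  ext i
  refine Fin.addCases (fun i => ?_) (fun i => ?_) i <;>
    simp [y, z, FreeAlgebra.lift_ι_apply]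

theorem half_smul_add_self [CharZero K] (x : A) : (2⁻¹ : K) • (x + x) = x := by
  rw [← two_smul K x, smul_smul, inv_mul_cancel₀ two_ne_zero, one_smul]

theorem IsStarCentralPolynomial.lift_mem_center [CharZero K] {σ : AlgInvolution K A} {r s : ℕ}
    {f : FreeAlgebra K (Fin (r + s))} (hf : IsStarCentralPolynomial σ (substYZ f))
    (b : Fin (r + s) → A) (hsymm : ∀ i : Fin r, σ (b (Fin.castAdd s i)) = b (Fin.castAdd s i))
    (hskew : ∀ j : Fin s, σ (b (Fin.natAdd r j)) = -b (Fin.natAdd r j)) :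
    FreeAlgebra.lift K b f ∈ Subalgebra.center K A := by
  -- `y i` and `z i` are built from the same variable, so its value is the sum of both targets.
  let p : ℕ → A := fun i => if h : i < r then b (Fin.castAdd s ⟨i, h⟩) else 0
  let q : ℕ → A := fun i => if h : i < s then b (Fin.natAdd r ⟨i, h⟩) else 0
  have hp (i : ℕ) : σ (p i) = p i := by
    by_cases h : i < r
    · simpa [p, h] using hsymm ⟨i, h⟩
    · simp [p, h]
  have hq (i : ℕ) : σ (q i) = -q i := by
    by_cases h : i < s
    · simpa [q, h] using hskew ⟨i, h⟩
    · simp [q, h]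
  have h := hf (fun i => p i + q i)
  rw [lift_substYZ] at h
  convert h using 2
  congr 1
  funext i
  refine Fin.addCases (fun i => ?_) (fun i => ?_) i
  · rw [Fin.append_left, map_add, hp, hq, add_add_add_comm, add_neg_cancel, add_zero,
      half_smul_add_self]
    simp [p, Fin.castAdd, Fin.castLE]
  · rw [Fin.append_right, map_add, hp, hq, add_sub_add_left_eq_sub, sub_neg_eq_add,
      half_smul_add_self]
    simp [q, Fin.natAdd]

/-- With a faithful skew centre, `*`-centrality of `f(y, z)` is centrality of `f`, without
any multilinearity assumption on `f`. -/
theorem isStarCentralPolynomial_substYZ_iff [CharZero K] {σ : AlgInvolution K A}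
    (hσ : HasFaithfulSkewCenter σ) {r s : ℕ} (f : FreeAlgebra K (Fin (r + s))) :
    IsStarCentralPolynomial σ (substYZ f) ↔ IsCentralPolynomial A f := by
  refine ⟨fun hf a => ?_, fun hf a => ?_⟩
  swap
  · rw [lift_substYZ]
    exact hf _
  rw [Subalgebra.mem_center_iff]
  intro b
  let P : Fin (r + s) → A := fun i => (2⁻¹ : K) • (a i + σ (a i))
  let Q : Fin (r + s) → A := fun i => (2⁻¹ : K) • (a i - σ (a i))
  have hP (i) : σ (P i) = P i := by
    simp only [P, map_smul, map_add, σ.involutive, add_comm]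
  have hQ (i) : σ (Q i) = -Q i := by
    simp only [Q, map_smul, map_sub, σ.involutive, ← smul_neg, neg_sub]
  have hPQ (i) : P i + Q i = a i := by
    simp only [P, Q]
    rw [← smul_add, add_add_sub_cancel, half_smul_add_self]
  -- Multiplication by the skew central variable exchanges symmetric and skew elements, so these
  -- polynomials take symmetric, respectively skew, values; at `X = 1` they specialize to `a`.
  let G : Fin (r + s) → A[X] := Fin.append
    (fun i => Polynomial.C (P (Fin.castAdd s i)) +
      Polynomial.C (Q (Fin.castAdd s i)) * Polynomial.X)
    (fun j => Polynomial.C (Q (Fin.natAdd r j)) +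
      Polynomial.C (P (Fin.natAdd r j)) * Polynomial.X)
  let F : A[X] := FreeAlgebra.lift K G f
  have hF (u : A) (hu : u ∈ Subalgebra.center K A) :
      evalCentral K u hu F = FreeAlgebra.lift K (fun i => (G i).eval u) f := by
    rw [← AlgHom.comp_apply]
    congr 1
    ext i
    simp [evalCentral_apply]
  have hzero : Polynomial.C b * F - F * Polynomial.C b = 0 := by
    refine hσ.polynomial_eq_zero _ fun u hu hus => ?_
    rw [← evalCentral_apply u hu, map_sub, map_mul, map_mul, hF, evalCentral_apply,
      Polynomial.eval_C, sub_eq_zero]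
    refine Subalgebra.mem_center_iff.mp (hf.lift_mem_center _ (fun i => ?_) (fun j => ?_)) b
    · simp only [G, Fin.append_left, Polynomial.eval_add, Polynomial.eval_C,
        Polynomial.eval_mul_X, map_add]
      rw [σ.map_mul_rev, hP, hQ, hus, neg_mul_neg, Subalgebra.mem_center_iff.mp hu]
    · simp only [G, Fin.append_right, Polynomial.eval_add, Polynomial.eval_C,
        Polynomial.eval_mul_X, map_add]
      rw [σ.map_mul_rev, hP, hQ, hus, neg_mul, Subalgebra.mem_center_iff.mp hu, neg_add]
  have hone := congrArg (evalCentral K (1 : A) (one_mem _)) hzero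
  rw [map_sub, map_mul, map_mul, hF, evalCentral_apply, Polynomial.eval_C, map_zero,
    sub_eq_zero] at hone
  have hG : (fun i => (G i).eval 1) = a := by
    funext i
    refine Fin.addCases (fun i => ?_) (fun i => ?_) i
    · simp [G, hPQ]
    · simp [G, add_comm, hPQ]
  rwa [hG] at hone

end General

/-! ### Central skew elements of the Grassmann algebra -/

section GrassmannAlgebra

variable {K : Type*} [Field K]

/-- Outside a finite-dimensional subspace, multiplication by a vector does not kill a given
nonzero `x`: contraction with a functional that vanishes on the vectors occurring in `x` recovers
`x` from `v * x`. -/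
theorem exists_finite_forall_mul_ne_zero (x : Grassmann K) (hx : x ≠ 0) :
    ∃ W : Submodule K (Grassmann K), W.FG ∧ ∀ v ∈ gens K, v ∉ W → v * x ≠ 0 := by
  have key : ∀ x : Grassmann K, ∃ W : Submodule K (ℕ →₀ K), W.FG ∧
      ∀ d : Module.Dual K (ℕ →₀ K), W ≤ LinearMap.ker d →
        CliffordAlgebra.contractLeft (Q := (0 : QuadraticForm K (ℕ →₀ K))) d x = 0 := by
    intro x
    induction x using CliffordAlgebra.left_induction with
    | algebraMap c => exact ⟨⊥, Submodule.fg_bot, fun d _ => by simp⟩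
    | add x y hx hy =>
      obtain ⟨W, hW, h⟩ := hx
      obtain ⟨W', hW', h'⟩ := hy
      refine ⟨W ⊔ W', hW.sup hW', fun d hd => ?_⟩
      rw [map_add, h d (le_sup_left.trans hd), h' d (le_sup_right.trans hd), add_zero]
    | ι_mul x m hx =>
      obtain ⟨W, hW, h⟩ := hx
      refine ⟨W ⊔ K ∙ m, hW.sup (Submodule.fg_span_singleton m), fun d hd => ?_⟩
      have hm : d m = 0 := hd (Submodule.mem_sup_right (Submodule.mem_span_singleton_self m))
      rw [CliffordAlgebra.contractLeft_ι_mul, h d (le_sup_left.trans hd), hm, zero_smul, mul_zero,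
        sub_zero]
  obtain ⟨W, hW, h⟩ := key x
  refine ⟨W.map (ExteriorAlgebra.ι K), hW.map _, ?_⟩
  rintro _ ⟨v, rfl⟩ hv h0
  obtain ⟨d, hdv, hd⟩ := Submodule.exists_le_ker_of_notMem
    (fun hvW => hv (Submodule.mem_map_of_mem hvW) : v ∉ W)
  have h1 := CliffordAlgebra.contractLeft_ι_mul (Q := (0 : QuadraticForm K (ℕ →₀ K))) d v x
  rw [h d hd, mul_zero, sub_zero] at h1
  rw [show CliffordAlgebra.ι (0 : QuadraticForm K (ℕ →₀ K)) v * x = 0 from h0, map_zero] at h1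
  exact (smul_ne_zero hdv hx) h1.symm

theorem gens_mul_swap {v w : Grassmann K} (hv : v ∈ gens K) (hw : w ∈ gens K) :
    w * v = -(v * w) := by
  obtain ⟨v, rfl⟩ := hv
  obtain ⟨w, rfl⟩ := hw
  exact eq_neg_of_add_eq_zero_left (ExteriorAlgebra.ι_add_mul_swap w v)

theorem gens_mul_self {v : Grassmann K} (hv : v ∈ gens K) : v * v = 0 := by
  obtain ⟨v, rfl⟩ := hv
  exact ExteriorAlgebra.ι_sq_zero v

theorem gens_mul_gens_mem_center {v w : Grassmann K} (hv : v ∈ gens K) (hw : w ∈ gens K) :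
    v * w ∈ Subalgebra.center K (Grassmann K) := by
  rw [Subalgebra.mem_center_iff]
  intro x
  induction x using CliffordAlgebra.left_induction with
  | algebraMap c => exact Algebra.commutes c _
  | add x y hx hy => rw [add_mul, mul_add, hx, hy]
  | ι_mul x m hx =>
    have hm : CliffordAlgebra.ι (0 : QuadraticForm K (ℕ →₀ K)) m ∈ gens K := ⟨m, rfl⟩
    rw [mul_assoc, hx, ← mul_assoc, ← mul_assoc, ← mul_assoc, gens_mul_swap hv hm, mul_assoc v,
      gens_mul_swap hm hw, neg_mul, mul_neg, mul_assoc v]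

theorem gens_mul_gens_mem_parity {v w : Grassmann K} (hv : v ∈ gens K) (hw : w ∈ gens K) :
    v * w ∈ parity K 0 := by
  obtain ⟨v, rfl⟩ := hv
  obtain ⟨w, rfl⟩ := hw
  exact CliffordAlgebra.ι_mul_ι_mem_evenOdd_zero _ v w

theorem not_fg_gens : ¬ (gens K).FG := by
  intro h
  have : Module.Finite K (gens K) := Module.Finite.iff_fg.mpr h
  have e : (ℕ →₀ K) ≃ₗ[K] gens K := LinearEquiv.ofInjective (ExteriorAlgebra.ι K)
    (ExteriorAlgebra.ι_leftInverse (R := K)).injective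
  have : Module.Finite K (ℕ →₀ K) := Module.Finite.equiv e.symm
  exact Infinite.not_finite (α := ℕ) (Module.Finite.finite_basis (Finsupp.basisSingleOne (R := K)))

/-- One of the two eigenspaces of the involution on `V` has infinite dimension. -/
theorem exists_eigenspace_not_fg [CharZero K] (β : AlgInvolution K (Grassmann K))
    (hβ : ∀ v ∈ gens K, β v ∈ gens K) :
    ∃ ε : K, ε * ε = 1 ∧
      ¬ (gens K ⊓ LinearMap.ker (β.toLinearMap - ε • LinearMap.id)).FG := by
  by_contra! h
  refine not_fg_gens (K := K) ?_
  have hsum := (h 1 (by norm_num)).sup (h (-1) (by norm_num))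
  convert hsum using 1
  refine le_antisymm ?_ ?_
  swap
  · exact sup_le inf_le_left inf_le_left
  · intro v hv
    have hdec : v = (2⁻¹ : K) • (v + β v) + (2⁻¹ : K) • (v - β v) := by
      rw [← smul_add, add_add_sub_cancel, half_smul_add_self]
    rw [hdec]
    refine Submodule.add_mem_sup ⟨Submodule.smul_mem _ _ (add_mem hv (hβ v hv)), ?_⟩
      ⟨Submodule.smul_mem _ _ (sub_mem hv (hβ v hv)), ?_⟩
    · rw [SetLike.mem_coe, LinearMap.mem_ker]
      simp [β.involutive, add_comm]
    · rw [SetLike.mem_coe, LinearMap.mem_ker]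
      simp [β.involutive, -smul_add]

theorem exists_mem_notMem_of_not_fg {M : Type*} [AddCommGroup M] [Module K M]
    {U W : Submodule K M} (hU : ¬ U.FG) (hW : W.FG) : ∃ v ∈ U, v ∉ W := by
  by_contra! h
  exact hU (Submodule.FG.of_le hW h)

/-- The products `v * w` of two vectors in the same eigenspace of `β` are central, and skew because
`β` reverses the two anticommuting factors. -/
theorem exists_skew_mul_ne_zero [CharZero K] (β : AlgInvolution K (Grassmann K))
    (hβ : ∀ v ∈ gens K, β v ∈ gens K) (x : Grassmann K) (hx : x ≠ 0) :
    ∃ u ∈ Subalgebra.center K (Grassmann K), u ∈ parity K 0 ∧ β u = -u ∧ u * u = 0 ∧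
      u * x ≠ 0 := by
  obtain ⟨ε, hε, hinf⟩ := exists_eigenspace_not_fg β hβ
  have heig {v : Grassmann K}
      (hv : v ∈ gens K ⊓ LinearMap.ker (β.toLinearMap - ε • LinearMap.id)) : β v = ε • v := by
    simpa [sub_eq_zero] using LinearMap.mem_ker.mp hv.2
  obtain ⟨W, hW, hWx⟩ := exists_finite_forall_mul_ne_zero x hx
  obtain ⟨w, hw, hwW⟩ := exists_mem_notMem_of_not_fg hinf hW
  obtain ⟨W', hW', hWx'⟩ := exists_finite_forall_mul_ne_zero _ (hWx w hw.1 hwW)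
  obtain ⟨v, hv, hvW⟩ := exists_mem_notMem_of_not_fg hinf hW'
  refine ⟨v * w, gens_mul_gens_mem_center hv.1 hw.1, gens_mul_gens_mem_parity hv.1 hw.1, ?_, ?_, ?_⟩
  · rw [β.map_mul_rev, heig hv, heig hw, smul_mul_smul_comm, hε, one_smul,
      gens_mul_swap hv.1 hw.1]
  · rw [mul_assoc, ← mul_assoc w, gens_mul_swap hv.1 hw.1, neg_mul, mul_assoc v, gens_mul_self hw.1,
      mul_zero, neg_zero, mul_zero]
  · rw [mul_assoc]
    exact hWx' v hv.1 hvW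

theorem AlgInvolution.map_mem_parity (β : AlgInvolution K (Grassmann K))
    (hβ : ∀ v ∈ gens K, β v ∈ gens K) {g : ZMod 2} {x : Grassmann K} (hx : x ∈ parity K g) :
    β x ∈ parity K g := by
  -- The powers of `V` span the two parity components, and reversing products preserves them.
  have hpow : ∀ (n : ℕ), ∀ x ∈ gens K ^ n, β x ∈ gens K ^ n := by
    intro n
    induction n with
    | zero =>
      intro x hx
      rw [pow_zero] at hx ⊢
      obtain ⟨c, rfl⟩ := Submodule.mem_one.mp hx
      rw [Algebra.algebraMap_eq_smul_one, map_smul, β.map_one, ← Algebra.algebraMap_eq_smul_one]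
      exact hx
    | succ n ih =>
      intro x hx
      rw [pow_succ] at hx
      rw [pow_succ']
      induction hx using Submodule.mul_induction_on' with
      | mem_mul_mem a ha b hb =>
        rw [β.map_mul_rev]
        exact Submodule.mul_mem_mul (hβ b hb) (ih a ha)
      | add a _ b _ ha hb =>
        rw [map_add]
        exact add_mem ha hb
  suffices parity K g ≤ (parity K g).comap β.toLinearMap from this hx
  refine iSup_le fun j x hx => ?_
  exact Submodule.mem_iSup_of_mem j (hpow j x hx)

end GrassmannAlgebra

/-! ### Matrices over the Grassmann algebra -/

section Matrices

variable {K : Type*} [Field K] {n : ℕ}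

theorem inducedInvolution_single (α : AlgInvolution K (Matrix (Fin n) (Fin n) K))
    (β : AlgInvolution K (Grassmann K)) (i j : Fin n) (w : Grassmann K) :
    inducedInvolution α β (Matrix.single i j w) =
      β w • (α (Matrix.single i j 1)).map (algebraMap K (Grassmann K)) := by
  change (matrixEquivTensor (Fin n) K (Grassmann K)).symm
    (TensorProduct.map β.toLinearMap α.toLinearMap
      (matrixEquivTensor (Fin n) K (Grassmann K) (Matrix.single i j w))) = _
  rw [matrixEquivTensor_apply_single, TensorProduct.map_tmul, matrixEquivTensor_apply_symm]

theorem inducedInvolution_scalar (α : AlgInvolution K (Matrix (Fin n) (Fin n) K))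
    (β : AlgInvolution K (Grassmann K)) (u : Grassmann K) :
    inducedInvolution α β (Matrix.scalar (Fin n) u) = Matrix.scalar (Fin n) (β u) := by
  have hs (w : Grassmann K) : (matrixEquivTensor (Fin n) K (Grassmann K)).symm
      (w ⊗ₜ[K] (1 : Matrix (Fin n) (Fin n) K)) = Matrix.scalar (Fin n) w := by
    rw [matrixEquivTensor_apply_symm, Matrix.map_one _ (map_zero _) (map_one _), Matrix.scalar_apply,
      Matrix.smul_one_eq_diagonal]
  rw [← hs u, ← hs (β u)]
  change (matrixEquivTensor (Fin n) K (Grassmann K)).symm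
    (TensorProduct.map β.toLinearMap α.toLinearMap
      (matrixEquivTensor (Fin n) K (Grassmann K) _)) = _
  rw [AlgEquiv.apply_symm_apply, TensorProduct.map_tmul, α.map_one]

/-- Scalar matrices reduce the faithfulness on matrices to that on the entries. -/
theorem exists_scalar_skew_mul_ne_zero [CharZero K]
    (α : AlgInvolution K (Matrix (Fin n) (Fin n) K)) (β : AlgInvolution K (Grassmann K))
    (hβ : ∀ v ∈ gens K, β v ∈ gens K) (x : Matrix (Fin n) (Fin n) (Grassmann K)) (hx : x ≠ 0) :
    ∃ u ∈ parity K 0, (∀ M, M * Matrix.scalar (Fin n) u = Matrix.scalar (Fin n) u * M) ∧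
      inducedInvolution α β (Matrix.scalar (Fin n) u) = -Matrix.scalar (Fin n) u ∧
      Matrix.scalar (Fin n) u * Matrix.scalar (Fin n) u = 0 ∧
      Matrix.scalar (Fin n) u * x ≠ 0 := by
  obtain ⟨i, j, hij⟩ : ∃ i j, x i j ≠ 0 := by
    by_contra! h
    exact hx (Matrix.ext h)
  obtain ⟨u, huc, hu0, hus, hu2, hux⟩ := exists_skew_mul_ne_zero β hβ _ hij
  refine ⟨u, hu0, fun M => ?_, ?_, ?_, fun h => hux ?_⟩
  · ext p q
    simp [Subalgebra.mem_center_iff.mp huc]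
  · rw [inducedInvolution_scalar, hus, map_neg]
  · rw [← map_mul, hu2, map_zero]
  · simpa using congrFun (congrFun h i) j

theorem hasFaithfulSkewCenter_inducedInvolution [CharZero K]
    (α : AlgInvolution K (Matrix (Fin n) (Fin n) K)) (β : AlgInvolution K (Grassmann K))
    (hβ : ∀ v ∈ gens K, β v ∈ gens K) : HasFaithfulSkewCenter (inducedInvolution α β) := by
  intro x hx
  obtain ⟨u, -, huc, h⟩ := exists_scalar_skew_mul_ne_zero α β hβ x hx
  exact ⟨_, Subalgebra.mem_center_iff.mpr huc, h⟩

theorem gradedComponent_apply_eq_zero {k l : ℕ} {g : ZMod 2}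
    {M : Matrix (Fin (k + l)) (Fin (k + l)) K} (hM : M ∈ gradedComponent K k l g)
    {p q : Fin (k + l)} (hpq : idxDeg k l q - idxDeg k l p ≠ g) : M p q = 0 := by
  induction hM using Submodule.span_induction with
  | mem x hx =>
    obtain ⟨i, j, hij, rfl⟩ := hx
    refine Matrix.single_apply_of_ne _ _ _ _ _ ?_
    rintro ⟨rfl, rfl⟩
    exact hpq hij
  | zero => rfl
  | add x y _ _ hx hy => rw [Matrix.add_apply, hx, hy, add_zero]
  | smul c x _ hx => rw [Matrix.smul_apply, hx, smul_zero]

theorem inducedInvolution_mem_Mkl {k l : ℕ}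
    (α : AlgInvolution K (Matrix (Fin (k + l)) (Fin (k + l)) K))
    (hα : ∀ g : ZMod 2, ∀ a ∈ gradedComponent K k l g, α a ∈ gradedComponent K k l g)
    (β : AlgInvolution K (Grassmann K)) (hβ : ∀ v ∈ gens K, β v ∈ gens K)
    {A : Matrix (Fin (k + l)) (Fin (k + l)) (Grassmann K)} (hA : A ∈ Mkl K k l) :
    inducedInvolution α β A ∈ Mkl K k l := by
  rw [Matrix.matrix_eq_sum_single A, map_sum]
  refine sum_mem fun i _ => ?_
  rw [map_sum]
  refine sum_mem fun j _ => ?_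
  rw [inducedInvolution_single]
  intro p q
  rw [Matrix.smul_apply, Matrix.map_apply, smul_eq_mul, ← Algebra.commutes, ← Algebra.smul_def]
  by_cases hpq : idxDeg k l q - idxDeg k l p = idxDeg k l j - idxDeg k l i
  · rw [hpq]
    exact Submodule.smul_mem _ _ (β.map_mem_parity hβ (hA i j))
  · rw [gradedComponent_apply_eq_zero
      (hα _ _ (Submodule.subset_span ⟨i, j, rfl, rfl⟩)) hpq, zero_smul]
    exact zero_mem _

theorem scalar_mem_Mkl {k l : ℕ} {u : Grassmann K} (hu : u ∈ parity K 0) :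
    Matrix.scalar (Fin (k + l)) u ∈ Mkl K k l := by
  intro i j
  rw [Matrix.scalar_apply, Matrix.diagonal_apply]
  split_ifs with h
  · rwa [h, sub_self]
  · exact zero_mem _

theorem hasFaithfulSkewCenter_restrict_Mkl [CharZero K] {k l : ℕ}
    (α : AlgInvolution K (Matrix (Fin (k + l)) (Fin (k + l)) K))
    (β : AlgInvolution K (Grassmann K)) (hβ : ∀ v ∈ gens K, β v ∈ gens K)
    (hγ : ∀ A ∈ Mkl K k l, inducedInvolution α β A ∈ Mkl K k l) :
    HasFaithfulSkewCenter ((inducedInvolution α β).restrict (Mkl K k l) hγ) := by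
  intro x hx
  obtain ⟨u, hu, huc, hus, hu2, hux⟩ := exists_scalar_skew_mul_ne_zero α β hβ (x : Matrix _ _ _)
    (fun h => hx (Subtype.ext h))
  exact ⟨⟨_, scalar_mem_Mkl hu⟩, Subalgebra.mem_center_iff.mpr fun M => Subtype.ext (huc M),
    Subtype.ext hus, Subtype.ext hu2, fun h => hux (congrArg Subtype.val h)⟩

end Matrices

end StarCentral

end

open StarCentral in
theorem corollary3p2 (K : Type*) [Field K] [CharZero K]
    (β : AlgInvolution K (Grassmann K)) (hβ : ∀ v ∈ gens K, β v ∈ gens K) :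
    (∀ (n : ℕ) (α : AlgInvolution K (Matrix (Fin n) (Fin n) K))
        (l m : ℕ) (f : FreeAlgebra K (Fin (l + m))),
        IsStarCentralPolynomial (inducedInvolution α β) (substYZ f) ↔
          IsCentralPolynomial (Matrix (Fin n) (Fin n) (Grassmann K)) f) ∧
    (∀ (k l : ℕ) (α : AlgInvolution K (Matrix (Fin (k + l)) (Fin (k + l)) K)),
        (∀ g : ZMod 2, ∀ a ∈ gradedComponent K k l g, α a ∈ gradedComponent K k l g) →
        ∃ hγ : ∀ A ∈ Mkl K k l, inducedInvolution α β A ∈ Mkl K k l,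
          ∀ (r s : ℕ) (f : FreeAlgebra K (Fin (r + s))),
            IsStarCentralPolynomial ((inducedInvolution α β).restrict (Mkl K k l) hγ)
                (substYZ f) ↔
              IsCentralPolynomial (Mkl K k l) f) := by
  refine ⟨fun n α l m f => ?_, fun k l α hα => ?_⟩
  · exact isStarCentralPolynomial_substYZ_iff (hasFaithfulSkewCenter_inducedInvolution α β hβ) f
  · have hγ : ∀ A ∈ Mkl K k l, inducedInvolution α β A ∈ Mkl K k l :=
      fun A hA => inducedInvolution_mem_Mkl α hα β hβ hA
    exact ⟨hγ, fun r s f => isStarCentralPolynomial_substYZ_iff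
      (hasFaithfulSkewCenter_restrict_Mkl α β hβ hγ) f⟩
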